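/- Let $k \leq n$ be positive integers, let $e_d$ denote the elementary symmetric polynomial of degree $d$ in $x_1,\dots,x_n$, and let $$R_{n,k} = \mathbb{Q}[x_1,\dots,x_n]/I_{n,k}, \qquad I_{n,k} = \langle x_1^k,\dots,x_n^k,\, e_n, e_{n-1},\dots,e_{n-k+1}\rangle ,$$ graded by degree. For $\pi = \pi_1\cdots\pi_n \in \mathfrak{S}_n$ let $\mathrm{Des}(\pi)=\{1\le i\le n-1 : \pi_i>\pi_{i+1}\}$, $\mathrm{Asc}(\pi)=\{1\le i\le n-1:\pi_i<\pi_{i+1}\}$, $\mathrm{des}(\pi)=|\mathrm{Des}(\pi)|$, $\mathrm{maj}(\pi)=\sum_{i\in \mathrm{Des}(\pi)} i$ and $gs_\pi=\prod_{i\in\mathrm{Des}(\pi)} x_{\pi_1}x_{\pi_2}\cdots x_{\pi_i}$. Let $$\mathcal{GS}_{n,k}=\{\, gs_\pi\cdot x_{\pi_1}^{i_1}\cdots x_{\pi_{n-k}}^{i_{n-k}} : \pi\in\mathfrak{S}_n,\ \mathrm{des}(\pi)<k,\ k-\mathrm{des}(\pi)>i_1\ge\cdots\ge i_{n-k}\ge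 0 \,\}.$$ Let $\mathcal{OP}_{n,k}$ be the set of ordered set partitions $\sigma=(B_1\mid\cdots\mid B_k)$ of $\{1,\dots,n\}$ into $k$ nonempty blocks. Write $\sigma$ as $(\pi,S)$, where $\pi$ is obtained by listing the blocks from left to right, each in increasing order, and $S$ is the set of positions $i$ such that $\pi_i$ and $\pi_{i+1}$ lie in the same block. Put $$\mathrm{maj}(\sigma)=\mathrm{maj}(\pi^c)-\sum_{i\in S}|\mathrm{Asc}(\pi)\cap\{i,i+1,\dots,n-1\}|,\qquad \pi^c_i=n+1-\pi_i,$$ and $\mathrm{comaj}(\sigma)=\max_{\sigma'\in\mathcal{OP}_{n,k}}\mathrm{maj}(\sigma')-\mathrm{maj}(\sigma)$. Theorem. The set $\mathcal{GS}_{n,k}$ descends to a basis of the $\mathbb{Q}$-vector space $R_{n,k}$. Different choices of $(\pi,(i_1,\dots,i_{n-k}))$ satisfying the conditions above give different monomials, $\mathcal{GS}_{n,k}$ is finite, and $$\mathrm{Hilb}(R_{n,k};q)=\sum_{m\in\mathcal{GS}_{n,k}}q^{\deg m}=\sum_{\sigma\in\mathcal{OP}_{n,k}}q^{\mathrm{comaj}(\sigma)},$$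 where $\mathrm{Hilb}(R_{n,k};q)=\sum_{d\ge0}\dim_{\mathbb{Q}}\big((R_{n,k})_d\big)\,q^d$ is the Hilbert series. -/

import Mathlib

open scoped Polynomial

namespace GarsiaStanton

noncomputable section

/-- The ideal `⟨x_1^k, …, x_n^k, e_n, e_{n-1}, …, e_{n-k+1}⟩` of `ℚ[x_1, …, x_n]`. -/
def idealI (n k : ℕ) : Ideal (MvPolynomial (Fin n) ℚ) :=
  Ideal.span
    (Set.range (fun i : Fin n => (MvPolynomial.X i : MvPolynomial (Fin n) ℚ) ^ k) ∪
      (fun d : ℕ => MvPolynomial.esymm (Fin n) ℚ d) '' Set.Icc (n - k + 1) n)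

/-- The generalized coinvariant algebra `R_{n,k}`. -/
abbrev ringR (n k : ℕ) : Type := MvPolynomial (Fin n) ℚ ⧸ idealI n k

/-- The degree `d` component of `R_{n,k}`: the classes of the homogeneous polynomials of
degree `d`. -/
def gradedPiece (n k d : ℕ) : Submodule ℚ (ringR n k) :=
  (MvPolynomial.homogeneousSubmodule (Fin n) ℚ d).map
    (Ideal.Quotient.mkₐ ℚ (idealI n k)).toLinearMap

/-- The Hilbert series `∑_d dim (R_{n,k})_d q^d`. -/
def hilbertSeries (n k : ℕ) : PowerSeries ℕ :=
  PowerSeries.mk fun d => Module.finrank ℚ (gradedPiece n k d)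

end

/-! Permutations in one-line notation. Letters and positions are elements of `Fin n`, so the
`i`-th letter (`1 ≤ i ≤ n`) of `π` is `π a` with `(a : ℕ) + 1 = i`. Descents and ascents are
recorded by their 1-based positions. -/

/-- `Des(π) = {1 ≤ i ≤ n-1 : π_i > π_{i+1}}`. -/
def desSet {n : ℕ} (π : Equiv.Perm (Fin n)) : Finset ℕ :=
  (Finset.Ico 1 n).filter fun i =>
    ∃ a b : Fin n, (a : ℕ) + 1 = i ∧ (b : ℕ) = i ∧ π b < π a

/-- `Asc(π) = {1 ≤ i ≤ n-1 : π_i < π_{i+1}}`. -/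
def ascSet {n : ℕ} (π : Equiv.Perm (Fin n)) : Finset ℕ :=
  (Finset.Ico 1 n).filter fun i =>
    ∃ a b : Fin n, (a : ℕ) + 1 = i ∧ (b : ℕ) = i ∧ π a < π b

/-- `des(π)`, the number of descents. -/
def des {n : ℕ} (π : Equiv.Perm (Fin n)) : ℕ := (desSet π).card

/-- `maj(π)`, the sum of the descents. -/
def maj {n : ℕ} (π : Equiv.Perm (Fin n)) : ℕ := ∑ i ∈ desSet π, i

/-! Garsia–Stanton monomials. -/

noncomputable section

/-- `gs_π = ∏_{i ∈ Des(π)} x_{π_1} ⋯ x_{π_i}`. -/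
def gs {n : ℕ} (π : Equiv.Perm (Fin n)) : MvPolynomial (Fin n) ℚ :=
  ∏ i ∈ desSet π, ∏ a ∈ Finset.univ.filter (fun a : Fin n => (a : ℕ) < i), MvPolynomial.X (π a)

/-- `gs_π · x_{π_1}^{i_1} ⋯ x_{π_{n-k}}^{i_{n-k}}`. -/
def gsMonomial {n : ℕ} (k : ℕ) (π : Equiv.Perm (Fin n)) (i : Fin (n - k) → ℕ) :
    MvPolynomial (Fin n) ℚ :=
  gs π * ∏ j : Fin (n - k), MvPolynomial.X (π (Fin.castLE (Nat.sub_le n k) j)) ^ i j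

end

/-- `des(π) < k` and `k - des(π) > i_1 ≥ ⋯ ≥ i_{n-k} ≥ 0`. -/
def IsAdmissible {n : ℕ} (k : ℕ) (π : Equiv.Perm (Fin n)) (i : Fin (n - k) → ℕ) : Prop :=
  des π < k ∧ Antitone i ∧ ∀ j, i j < k - des π

/-- The set `𝒢𝒮_{n,k}` of `(n,k)`-Garsia–Stanton monomials. -/
def gsSet (n k : ℕ) : Set (MvPolynomial (Fin n) ℚ) :=
  {m | ∃ (π : Equiv.Perm (Fin n)) (i : Fin (n - k) → ℕ),
    IsAdmissible k π i ∧ m = gsMonomial k π i}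

/-! Ordered set partitions. -/

/-- An ordered set partition `(B_1 | ⋯ | B_k)` of an `n`-element set, given by the function that
sends a letter to the index of its block; all blocks are nonempty. -/
abbrev OrderedSetPartition (n k : ℕ) : Type := {f : Fin n → Fin k // Function.Surjective f}

namespace OrderedSetPartition

variable {n k : ℕ}

/-- The permutation of the star notation: the blocks are written from left to right, and the
letters of each block in increasing order (`Tuple.sort` breaks ties by size of the letter). -/
def perm (σ : OrderedSetPartition n k) : Equiv.Perm (Fin n) := Tuple.sort σ.1

/-- The set of starred positions: `i` with `π_i` and `π_{i+1}` in the same block. -/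
def stars (σ : OrderedSetPartition n k) : Finset ℕ :=
  (Finset.Ico 1 n).filter fun i =>
    ∃ a b : Fin n, (a : ℕ) + 1 = i ∧ (b : ℕ) = i ∧ σ.1 (σ.perm a) = σ.1 (σ.perm b)

/-- `maj(σ) = maj(π^c) - ∑_{i ∈ S} |Asc(π) ∩ {i, …, n-1}|` for the star notation `(π, S)` of `σ`,
where `π^c` is obtained from `π` by replacing each letter `a` by `n + 1 - a`. The subtraction
never truncates, see `starSum_le_maj`. -/
def maj (σ : OrderedSetPartition n k) : ℕ :=
  GarsiaStanton.maj (Fin.revPerm * σ.perm) -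
    ∑ i ∈ σ.stars, (ascSet σ.perm ∩ Finset.Ico i n).card

/-- `comaj(σ) = max {maj(σ') : σ'} - maj(σ)`. -/
def comaj (σ : OrderedSetPartition n k) : ℕ :=
  (Finset.univ.sup fun τ : OrderedSetPartition n k => τ.maj) - σ.maj

theorem stars_subset_ascSet (σ : OrderedSetPartition n k) : σ.stars ⊆ ascSet σ.perm := by
  intro i hi
  simp only [stars, ascSet, Finset.mem_filter] at hi ⊢
  obtain ⟨h, a, b, ha, hb, hab⟩ := hi
  refine ⟨h, a, b, ha, hb, ?_⟩
  have := (Tuple.eq_sort_iff (f := σ.1) (σ := σ.perm)).1 rfl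
  exact this.2 a b (by rw [Fin.lt_def]; omega) hab

theorem starSum_le_maj (σ : OrderedSetPartition n k) :
    ∑ i ∈ σ.stars, (ascSet σ.perm ∩ Finset.Ico i n).card ≤
      GarsiaStanton.maj (Fin.revPerm * σ.perm) := by
  have h1 : desSet (Fin.revPerm * σ.perm) = ascSet σ.perm := by
    ext i; simp [desSet, ascSet]
  rw [GarsiaStanton.maj, h1]
  refine (Finset.sum_le_sum_of_subset σ.stars_subset_ascSet).trans ?_
  set A := ascSet σ.perm
  have h2 : ∀ i ∈ A, (A ∩ Finset.Ico i n).card ≤ ∑ j ∈ A, if i ≤ j then 1 else 0 := by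
    intro i _
    rw [← Finset.card_filter]
    apply Finset.card_le_card
    intro j hj
    simp at hj ⊢
    tauto
  refine (Finset.sum_le_sum h2).trans ?_
  rw [Finset.sum_comm]
  refine Finset.sum_le_sum fun j _ => ?_
  rw [← Finset.card_filter]
  have h3 : A.filter (fun i => i ≤ j) ⊆ Finset.Icc 1 j := by
    intro i hi
    simp only [A, ascSet, Finset.mem_filter, Finset.mem_Ico, Finset.mem_Icc] at hi ⊢
    omega
  simpa using Finset.card_le_card h3

end OrderedSetPartition

end GarsiaStanton

open GarsiaStanton

/-! Spanning comes from straightening. List the variables of `x^a` by decreasing exponent, ties by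
index; if `π` is the resulting permutation, `gs_π` divides `x^a`. When all exponents are below `k`
and the quotient involves only the first `n - k` listed variables, `x^a` is a Garsia–Stanton
monomial. When the quotient involves a later variable, `x^a` is the leading term of some `x^b e_d`
with `d > n - k`, so modulo the ideal it is a combination of smaller monomials of the same degree
(`straighten_cases`, `exists_straightening`).

Independence comes from evaluation at the ordered set partitions, seen as points of `{0, …, k-1}^n`.
Each generator of the ideal is the top form of a polynomial vanishing at all these points, so a
homogeneous component of degree `d` of an element of the ideal agrees on the points with a
polynomial of degree below `d` (`evalPoints_homogeneousComponent_mem`). With straightening, the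
Garsia–Stanton monomials span all functions on the points. There are as many monomials as points
(`toMonomial_bijective`), so they form a basis of functions, and one graded component of a relation
modulo the ideal would give a relation between functions.

The bijection sends `(π, S)` to `π` and the ranks of the stars among the ascents, counted from the
right, minus a staircase. Under it `maj σ` plus the degree is constant (`maj_add`), so the degree is
`comaj σ`. -/

namespace GarsiaStanton

open MvPolynomial

variable {n : ℕ}

/-! Descents and the exponents of Garsia–Stanton monomials. -/

theorem mem_desSet_iff {π : Equiv.Perm (Fin n)} {p q : Fin n} (h : (p : ℕ) + 1 = q) :
    (q : ℕ) ∈ desSet π ↔ π q < π p := by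
  simp only [desSet, Finset.mem_filter, Finset.mem_Ico]
  constructor
  · rintro ⟨-, a, b, ha, hb, hab⟩
    obtain rfl : b = q := Fin.ext hb
    obtain rfl : a = p := Fin.ext (by omega)
    exact hab
  · intro hab
    exact ⟨⟨by omega, q.2⟩, p, q, h, rfl, hab⟩

theorem mem_ascSet_iff {π : Equiv.Perm (Fin n)} {p q : Fin n} (h : (p : ℕ) + 1 = q) :
    (q : ℕ) ∈ ascSet π ↔ π p < π q := by
  simp only [ascSet, Finset.mem_filter, Finset.mem_Ico]
  constructor
  · rintro ⟨-, a, b, ha, hb, hab⟩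
    obtain rfl : b = q := Fin.ext hb
    obtain rfl : a = p := Fin.ext (by omega)
    exact hab
  · intro hab
    exact ⟨⟨by omega, q.2⟩, p, q, h, rfl, hab⟩

theorem desSet_subset_Ico (π : Equiv.Perm (Fin n)) : desSet π ⊆ Finset.Ico 1 n :=
  Finset.filter_subset _ _

theorem ascSet_subset_Ico (π : Equiv.Perm (Fin n)) : ascSet π ⊆ Finset.Ico 1 n :=
  Finset.filter_subset _ _

/-- The number of descents at or after the `j`-th letter (with `j` counted from `0`). -/
def desAfter (π : Equiv.Perm (Fin n)) (j : Fin n) : ℕ :=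
  ((desSet π).filter fun i => (j : ℕ) < i).card

theorem desAfter_antitone (π : Equiv.Perm (Fin n)) : Antitone (desAfter π) := by
  intro p q h
  refine Finset.card_le_card fun i => ?_
  simp only [Finset.mem_filter]
  exact fun hi => ⟨hi.1, lt_of_le_of_lt h hi.2⟩

theorem desAfter_zero (π : Equiv.Perm (Fin n)) {j : Fin n} (hj : (j : ℕ) = 0) :
    desAfter π j = des π := by
  rw [desAfter, des, Finset.filter_true_of_mem]
  intro i hi
  have := Finset.mem_Ico.1 (desSet_subset_Ico π hi)
  omega

theorem desAfter_last (π : Equiv.Perm (Fin n)) {j : Fin n} (hj : (j : ℕ) + 1 = n) :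
    desAfter π j = 0 := by
  rw [desAfter, Finset.card_eq_zero, Finset.filter_eq_empty_iff]
  intro i hi
  have := Finset.mem_Ico.1 (desSet_subset_Ico π hi)
  omega

theorem desAfter_succ (π : Equiv.Perm (Fin n)) {p q : Fin n} (h : (p : ℕ) + 1 = q) :
    desAfter π p = desAfter π q + if π q < π p then 1 else 0 := by
  simp only [← mem_desSet_iff h, desAfter]
  have : (desSet π).filter (fun i => (p : ℕ) < i) =
      (desSet π).filter (fun i => (q : ℕ) < i) ∪ (desSet π).filter (fun i => i = q) := by
    rw [← Finset.filter_or]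
    refine Finset.filter_congr fun i _ => ?_
    omega
  rw [this, Finset.card_union_of_disjoint]
  · congr 1
    rw [Finset.filter_eq']
    split_ifs <;> simp
  · rw [Finset.disjoint_filter]
    intros
    omega

theorem sum_desAfter (π : Equiv.Perm (Fin n)) : ∑ j, desAfter π j = maj π := by
  simp only [desAfter, Finset.card_filter]
  rw [Finset.sum_comm, maj]
  refine Finset.sum_congr rfl fun i hi => ?_
  have hi' := Finset.mem_Ico.1 (desSet_subset_Ico π hi)
  rw [← Finset.card_filter, Fin.card_filter_val_lt]
  omega

/-- A property of adjacent positions that is transitive holds for all pairs of positions. -/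
theorem rel_of_adjacent {r : Fin n → Fin n → Prop} (ht : ∀ p q s, r p q → r q s → r p s)
    {p q : Fin n} (hpq : p < q)
    (h : ∀ u v : Fin n, p ≤ u → v ≤ q → (u : ℕ) + 1 = v → r u v) : r p q := by
  obtain ⟨q, hq⟩ := q
  induction q with
  | zero => simp [Fin.lt_def] at hpq
  | succ q ih =>
    have hq' : q < n := by omega
    have hlast : r ⟨q, hq'⟩ ⟨q + 1, hq⟩ := h _ _ (by
      rw [Fin.lt_def] at hpq; rw [Fin.le_def]; simp at hpq ⊢; omega) le_rfl rfl
    rcases eq_or_ne (p : ℕ) q with e | e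
    · have : p = ⟨q, hq'⟩ := Fin.ext e
      rwa [this]
    · refine ht _ _ _ (ih hq' (by rw [Fin.lt_def] at hpq ⊢; simp at hpq ⊢; omega)
        fun u v hu hv => h u v hu (hv.trans ?_)) hlast
      rw [Fin.le_def]; simp

theorem perm_lt_of_desAfter_eq {π : Equiv.Perm (Fin n)} {p q : Fin n} (hpq : p < q)
    (h : desAfter π p = desAfter π q) : π p < π q := by
  refine rel_of_adjacent (r := fun p q => π p < π q) (fun _ _ _ => lt_trans) hpq ?_
  intro u v hu hv huv
  have h1 := desAfter_antitone π hu
  have h2 := desAfter_antitone π hv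
  have h3 := desAfter_succ π huv
  have : ¬ π v < π u := fun hlt => by rw [if_pos hlt] at h3; omega
  refine lt_of_le_of_ne (not_lt.1 this) fun e => ?_
  have := congrArg Fin.val (π.injective e)
  omega

/-- The extension of a sequence by zeros. -/
def extendZero (k : ℕ) (i : Fin (n - k) → ℕ) (j : Fin n) : ℕ :=
  if h : (j : ℕ) < n - k then i ⟨j, h⟩ else 0

theorem extendZero_antitone {k : ℕ} {i : Fin (n - k) → ℕ} (hi : Antitone i) :
    Antitone (extendZero k i) := by
  intro p q h
  rw [Fin.le_def] at h
  unfold extendZero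
  split_ifs with h1 h2
  · exact hi h
  · omega
  · exact Nat.zero_le _
  · exact le_rfl

theorem sum_extendZero (k : ℕ) (i : Fin (n - k) → ℕ) :
    ∑ j, extendZero k i j = ∑ j, i j := by
  refine (Finset.sum_of_injOn (Fin.castLE (Nat.sub_le n k))
    (fun a _ b _ h => by simpa using h) (by simp) ?_ ?_).symm
  · intro j _ hj
    refine dif_neg fun h => hj ?_
    exact ⟨⟨j, h⟩, by simp, rfl⟩
  · intro j _
    simp [extendZero]

/-- The exponent vector of a Garsia–Stanton monomial. -/
noncomputable def gsExp (k : ℕ) (π : Equiv.Perm (Fin n)) (i : Fin (n - k) → ℕ) : Fin n →₀ ℕ :=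
  Finsupp.equivFunOnFinite.symm fun x => desAfter π (π.symm x) + extendZero k i (π.symm x)

theorem gsExp_apply (k : ℕ) (π : Equiv.Perm (Fin n)) (i : Fin (n - k) → ℕ) (j : Fin n) :
    gsExp k π i (π j) = desAfter π j + extendZero k i j := by
  simp [gsExp]

theorem gs_eq (π : Equiv.Perm (Fin n)) : gs π = ∏ j, X (π j) ^ desAfter π j := by
  unfold gs desAfter
  simp_rw [Finset.prod_filter]
  rw [Finset.prod_comm]
  refine Finset.prod_congr rfl fun j _ => ?_
  rw [← Finset.prod_filter, Finset.prod_const]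

theorem prod_X_extendZero (k : ℕ) (π : Equiv.Perm (Fin n)) (i : Fin (n - k) → ℕ) :
    ∏ j : Fin (n - k), (X (π (Fin.castLE (Nat.sub_le n k) j)) : MvPolynomial (Fin n) ℚ) ^ i j =
      ∏ j, X (π j) ^ extendZero k i j := by
  refine Finset.prod_of_injOn (Fin.castLE (Nat.sub_le n k))
    (fun a _ b _ h => by simpa using h) (by simp) ?_ ?_
  · intro j _ hj
    have : extendZero k i j = 0 := dif_neg fun h => hj ⟨⟨j, h⟩, by simp, rfl⟩
    rw [this, pow_zero]
  · intro j _
    simp [extendZero]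

theorem gsMonomial_eq (k : ℕ) (π : Equiv.Perm (Fin n)) (i : Fin (n - k) → ℕ) :
    gsMonomial k π i = monomial (gsExp k π i) 1 := by
  rw [gsMonomial, gs_eq, prod_X_extendZero, ← Finset.prod_mul_distrib, monomial_eq, C_1, one_mul,
    Finsupp.prod_fintype _ _ (fun _ => pow_zero _), ← Equiv.prod_comp π (fun x => X x ^ gsExp k π i x)]
  refine Finset.prod_congr rfl fun j _ => ?_
  rw [gsExp_apply, pow_add]

theorem degree_gsExp (k : ℕ) (π : Equiv.Perm (Fin n)) (i : Fin (n - k) → ℕ) :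
    (gsExp k π i).degree = maj π + ∑ j, i j := by
  rw [Finsupp.degree_eq_sum, ← Equiv.sum_comp π, ← sum_desAfter, ← sum_extendZero,
    ← Finset.sum_add_distrib]
  exact Finset.sum_congr rfl fun j _ => gsExp_apply k π i j

theorem totalDegree_gsMonomial (k : ℕ) (π : Equiv.Perm (Fin n)) (i : Fin (n - k) → ℕ) :
    (gsMonomial k π i).totalDegree = maj π + ∑ j, i j := by
  rw [gsMonomial_eq, ← degree_gsExp]
  exact (isHomogeneous_monomial 1 rfl).totalDegree (by simp)

/-- The permutation that lists the variables by decreasing exponent, ties being broken by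
increasing index. -/
def sortPerm (a : Fin n → ℕ) : Equiv.Perm (Fin n) := Tuple.sort fun x => OrderDual.toDual (a x)

/-- Both summands of the exponent weakly decrease along `π`. A tie forces equality in each summand,
hence no descent in between, so tied letters increase; this characterizes the stable sort. Thus `π`
can be read off from the monomial. -/
theorem eq_sortPerm_gsExp {k : ℕ} {π : Equiv.Perm (Fin n)} {i : Fin (n - k) → ℕ}
    (hi : Antitone i) : π = sortPerm (gsExp k π i) := by
  refine Tuple.eq_sort_iff.2 ⟨?_, ?_⟩
  · intro p q hpq
    simp only [Function.comp_apply, gsExp_apply, OrderDual.toDual_le_toDual]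
    exact add_le_add (desAfter_antitone π hpq) (extendZero_antitone hi hpq)
  · intro p q hpq h
    simp only [gsExp_apply, OrderDual.toDual_inj] at h
    have h1 := desAfter_antitone π hpq.le
    have h2 := extendZero_antitone hi hpq.le
    exact perm_lt_of_desAfter_eq hpq (by omega)

theorem gsExp_injective {k : ℕ} {π π' : Equiv.Perm (Fin n)} {i i' : Fin (n - k) → ℕ}
    (hi : Antitone i) (hi' : Antitone i') (h : gsExp k π i = gsExp k π' i') :
    π = π' ∧ i = i' := by
  obtain rfl : π = π' := by
    have h1 := eq_sortPerm_gsExp hi (π := π)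
    rw [h] at h1
    rw [h1, ← eq_sortPerm_gsExp hi']
  refine ⟨rfl, funext fun j => ?_⟩
  have := DFunLike.congr_fun h (π (Fin.castLE (Nat.sub_le n k) j))
  rw [gsExp_apply, gsExp_apply] at this
  simpa [extendZero] using this

theorem gsMonomial_injective {k : ℕ} {π π' : Equiv.Perm (Fin n)} {i i' : Fin (n - k) → ℕ}
    (hi : Antitone i) (hi' : Antitone i') (h : gsMonomial k π i = gsMonomial k π' i') :
    π = π' ∧ i = i' := by
  rw [gsMonomial_eq, gsMonomial_eq] at h
  exact gsExp_injective hi hi' (monomial_left_injective one_ne_zero h)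

/-! Straightening. -/

theorem sortPerm_antitone (a : Fin n → ℕ) : Antitone (a ∘ sortPerm a) :=
  (Tuple.eq_sort_iff.1 (rfl : sortPerm a = _)).1

theorem sortPerm_lt (a : Fin n → ℕ) {p q : Fin n} (hpq : p < q)
    (h : a (sortPerm a p) = a (sortPerm a q)) : sortPerm a p < sortPerm a q :=
  (Tuple.eq_sort_iff.1 (rfl : sortPerm a = _)).2 p q hpq (congrArg OrderDual.toDual h)

/-- Ties are listed in increasing order, so a descent of `sortPerm a` forces a strict drop of the
exponent. Hence the exponents left after division by `gs_π` weakly decrease along the list. -/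
theorem desAfter_add_le (a : Fin n → ℕ) {p q : Fin n} (hpq : p ≤ q) :
    desAfter (sortPerm a) p + a (sortPerm a q) ≤ a (sortPerm a p) + desAfter (sortPerm a) q := by
  rcases hpq.eq_or_lt with rfl | hpq
  · omega
  refine rel_of_adjacent (r := fun p q => desAfter (sortPerm a) p + a (sortPerm a q) ≤
    a (sortPerm a p) + desAfter (sortPerm a) q) (fun p q s h1 h2 => by omega) hpq ?_
  intro u v _ _ huv
  have huv' : u < v := by rw [Fin.lt_def]; omega
  have h1 : a (sortPerm a v) ≤ a (sortPerm a u) := sortPerm_antitone a huv'.le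
  rw [desAfter_succ _ huv]
  split_ifs with h
  · rcases h1.eq_or_lt with e | e
    · exact absurd (sortPerm_lt a huv' e.symm) h.not_gt
    · omega
  · omega

theorem desAfter_le (a : Fin n → ℕ) (p : Fin n) :
    desAfter (sortPerm a) p ≤ a (sortPerm a p) := by
  have hp := p.2
  have h := desAfter_add_le a (p := p) (q := ⟨n - 1, by omega⟩)
    (Fin.le_def.2 (Nat.le_pred_of_lt p.2))
  have h0 : desAfter (sortPerm a) ⟨n - 1, by omega⟩ = 0 :=
    desAfter_last _ (Nat.sub_add_cancel (by omega))
  omega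

/-- The quantity that decreases in a straightening step. -/
def straightWeight (a : Fin n → ℕ) : ℕ := ∑ x : Fin n, (n * a x ^ 2 + 2 * (n - x) * a x)

/-- After cancelling `s ∩ t`, the two differences are nonempty and equinumerous, and every weight in
`s \ t` is below every weight in `t \ s`. -/
theorem sum_lt_sum_of_card_eq {ι : Type*} [DecidableEq ι] {s t : Finset ι} {w : ι → ℕ}
    (hst : s ≠ t) (hc : s.card = t.card) (h : ∀ x ∈ t, ∀ y ∉ t, w y < w x) :
    ∑ x ∈ s, w x < ∑ x ∈ t, w x := by
  rw [← Finset.sum_sdiff (Finset.inter_subset_left : s ∩ t ⊆ s),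
    ← Finset.sum_sdiff (Finset.inter_subset_right : s ∩ t ⊆ t), add_lt_add_iff_right,
    Finset.sdiff_inter_self_left, Finset.sdiff_inter_self_right]
  have hcard : (s \ t).card = (t \ s).card := by
    have h1 := Finset.card_sdiff_add_card_inter s t
    have h2 := Finset.card_sdiff_add_card_inter t s
    rw [Finset.inter_comm] at h2
    omega
  have hne : (s \ t).Nonempty := by
    rw [Finset.sdiff_nonempty]
    exact fun hs => hst (Finset.eq_of_subset_of_card_le hs hc.ge)
  have hpos := hne.card_pos
  obtain ⟨y, hy, hmax⟩ := Finset.exists_max_image (s \ t) w hne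
  have h1 := Finset.sum_le_card_nsmul (s \ t) w (w y) hmax
  have h2 := Finset.card_nsmul_le_sum (t \ s) w (w y + 1) fun x hx =>
    h x (Finset.mem_sdiff.1 hx).1 y (Finset.mem_sdiff.1 hy).2
  rw [← hcard] at h2
  simp only [smul_eq_mul, mul_add, mul_one] at h1 h2
  linarith

/-- The exponent vector of the squarefree monomial `∏_{x ∈ T} x`. -/
noncomputable def indicatorExp (T : Finset (Fin n)) : Fin n →₀ ℕ := ∑ x ∈ T, Finsupp.single x 1

theorem indicatorExp_apply (T : Finset (Fin n)) (x : Fin n) :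
    indicatorExp T x = if x ∈ T then 1 else 0 := by
  simp [indicatorExp, Finsupp.finsetSum_apply, Finsupp.single_apply]

theorem degree_indicatorExp (T : Finset (Fin n)) : (indicatorExp T).degree = T.card := by
  simp [Finsupp.degree_eq_sum, indicatorExp_apply]

/-- Raising the exponent of `x` by one costs `2n·b x + n + 2(n - x)`. The last term varies by less
than `2n`, so these costs compare first by exponent and then by smaller index, as in `sortPerm`. -/
theorem straightWeight_add_indicatorExp (b : Fin n →₀ ℕ) (T : Finset (Fin n)) :
    straightWeight (b + indicatorExp T) =
      straightWeight b + ∑ x ∈ T, (2 * n * b x + n + 2 * (n - x)) := by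
  rw [straightWeight, straightWeight, ← Finset.sum_filter_add_sum_filter_not Finset.univ (· ∈ T),
    ← Finset.sum_filter_add_sum_filter_not (s := Finset.univ)
      (f := fun x : Fin n => n * b x ^ 2 + 2 * (n - x) * b x) (p := (· ∈ T))]
  simp only [Finset.filter_univ_mem]
  rw [add_right_comm, ← Finset.sum_add_distrib]
  congr 1
  · refine Finset.sum_congr rfl fun x hx => ?_
    simp only [Finsupp.add_apply, indicatorExp_apply, if_pos hx]
    ring
  · refine Finset.sum_congr rfl fun x hx => ?_
    simp only [Finset.mem_filter, Finset.mem_univ, true_and] at hx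
    simp only [Finsupp.add_apply, indicatorExp_apply, if_neg hx, add_zero]

/-- If all variables of `T₀` precede all others in the order by decreasing exponent in `b`
(ties broken by index), then `b + T₀` has the largest weight among all `b + T`. -/
theorem straightWeight_lt {b : Fin n →₀ ℕ} {T T₀ : Finset (Fin n)} (hT : T ≠ T₀)
    (hc : T.card = T₀.card)
    (h : ∀ x ∈ T₀, ∀ y ∉ T₀, b y < b x ∨ b y = b x ∧ x < y) :
    straightWeight (b + indicatorExp T) < straightWeight (b + indicatorExp T₀) := by
  rw [straightWeight_add_indicatorExp, straightWeight_add_indicatorExp, add_lt_add_iff_left]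
  refine sum_lt_sum_of_card_eq hT hc fun x hx y hy => ?_
  have hxn := x.2
  have hyn := y.2
  rcases h x hx y hy with h | ⟨h, hxy⟩
  · have : n * (b y + 1) ≤ n * b x := Nat.mul_le_mul_left _ h
    rw [mul_assoc, mul_assoc]
    rw [mul_add] at this
    omega
  · rw [Fin.lt_def] at hxy
    rw [h]
    omega

theorem monomial_mul_esymm (b : Fin n →₀ ℕ) (d : ℕ) :
    monomial b 1 * esymm (Fin n) ℚ d =
      ∑ T ∈ Finset.powersetCard d Finset.univ, monomial (b + indicatorExp T) 1 := by
  rw [esymm_eq_sum_monomial, Finset.mul_sum]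
  exact Finset.sum_congr rfl fun T _ => by rw [monomial_mul, one_mul]; rfl

/-- The Garsia–Stanton monomials of degree `d`. -/
def gsSetDeg (n k d : ℕ) : Set (MvPolynomial (Fin n) ℚ) := {m ∈ gsSet n k | m.totalDegree = d}

/-- A monomial is in the ideal, or a Garsia–Stanton monomial, or it is the largest term in a
multiple of one of the generators `e_d`. -/
theorem straighten_cases {k : ℕ} (hk : 0 < k) (hkn : k ≤ n) (a : Fin n →₀ ℕ) :
    (∃ x, k ≤ a x) ∨ monomial a 1 ∈ gsSet n k ∨
      ∃ (b : Fin n →₀ ℕ) (T₀ : Finset (Fin n)), a = b + indicatorExp T₀ ∧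
        T₀.card ∈ Set.Icc (n - k + 1) n ∧
        ∀ x ∈ T₀, ∀ y ∉ T₀, b y < b x ∨ b y = b x ∧ x < y := by
  by_cases h1 : ∃ x, k ≤ a x
  · exact Or.inl h1
  refine Or.inr ?_
  push Not at h1
  set π := sortPerm a with hπ
  -- This says that the quotient by `gs_π` involves only the first `n - k` listed variables.
  by_cases h2 : ∀ j : Fin n, n - k ≤ j → a (π j) = desAfter π j
  · left
    refine ⟨π, fun j => a (π (Fin.castLE (Nat.sub_le n k) j)) -
      desAfter π (Fin.castLE (Nat.sub_le n k) j), ⟨?_, ?_, ?_⟩, ?_⟩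
    · rw [← desAfter_zero π (j := ⟨0, by omega⟩) rfl]
      exact (desAfter_le a _).trans_lt (h1 _)
    · intro p q hpq
      have h3 := desAfter_add_le a (p := Fin.castLE (Nat.sub_le n k) p)
        (q := Fin.castLE (Nat.sub_le n k) q) hpq
      have h4 := desAfter_le a (Fin.castLE (Nat.sub_le n k) q)
      simp only [← hπ] at h3 h4 ⊢
      omega
    · intro j
      rw [← desAfter_zero π (j := ⟨0, by omega⟩) rfl]
      have h3 := desAfter_add_le a (p := ⟨0, by omega⟩)
        (q := Fin.castLE (Nat.sub_le n k) j) (by simp [Fin.le_def])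
      have h4 := desAfter_le a (Fin.castLE (Nat.sub_le n k) j)
      have h5 := h1 (π ⟨0, by omega⟩)
      simp only [← hπ] at h3 h4 ⊢
      omega
    · rw [gsMonomial_eq]
      refine congrArg (fun e => monomial e (1 : ℚ)) (Finsupp.ext fun x => ?_)
      obtain ⟨j, rfl⟩ := π.surjective x
      rw [gsExp_apply, extendZero]
      split_ifs with hj
      · have h4 := desAfter_le a j
        simp only [← hπ, Fin.castLE_mk, Fin.eta] at h4 ⊢
        omega
      · rw [h2 j (by omega), add_zero]
  · right
    push Not at h2
    -- Take the last position `j` with an excess over `gs_π`. Excesses weakly decrease, so all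
    -- positions up to `j` have one, and their `j + 1 ≥ n - k + 1` variables form `T₀`.
    obtain ⟨j, hj⟩ : ∃ j, j ∈ Finset.univ.filter
        (fun j : Fin n => n - k ≤ j ∧ a (π j) ≠ desAfter π j) ∧
        ∀ q ∈ Finset.univ.filter
          (fun j : Fin n => n - k ≤ j ∧ a (π j) ≠ desAfter π j), q ≤ j := by
      obtain ⟨j, hj⟩ := h2
      exact Finset.exists_max_image _ id ⟨j, by simpa using hj⟩
    obtain ⟨hj, hmax⟩ := hj
    simp only [Finset.mem_filter, Finset.mem_univ, true_and] at hj hmax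
    have hlast : ∀ q, j < q → a (π q) = desAfter π q := by
      intro q hq
      by_contra hne
      have := hmax q ⟨hj.1.trans hq.le, hne⟩
      exact absurd hq this.not_gt
    have hfirst : ∀ p, p ≤ j → desAfter π p + 1 ≤ a (π p) := by
      intro p hp
      have h3 := desAfter_add_le a hp
      have h4 := desAfter_le a j
      have h5 := hj.2
      simp only [← hπ] at h3 h4
      omega
    set T₀ := (Finset.Iic j).map π.toEmbedding with hT₀
    have hmem : ∀ p, π p ∈ T₀ ↔ p ≤ j := by
      intro p
      simp [hT₀]
    have hle : indicatorExp T₀ ≤ a := by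
      intro x
      obtain ⟨p, rfl⟩ := π.surjective x
      simp only [indicatorExp_apply, hmem]
      split_ifs with hp
      · have := hfirst p hp
        omega
      · exact Nat.zero_le _
    refine ⟨a - indicatorExp T₀, T₀, (tsub_add_cancel_of_le hle).symm, ?_, ?_⟩
    · have hjn := j.2
      simp only [hT₀, Finset.card_map, Fin.card_Iic, Set.mem_Icc]
      omega
    · intro x hx y hy
      obtain ⟨p, rfl⟩ := π.surjective x
      obtain ⟨q, rfl⟩ := π.surjective y
      simp only [Finsupp.coe_tsub, Pi.sub_apply, indicatorExp_apply, if_pos hx, if_neg hy]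
      rw [hmem] at hx hy
      have hpq : p < q := hx.trans_lt (not_le.1 hy)
      have h3 := hfirst p hx
      have h4 := hlast q (not_le.1 hy)
      have h5 := desAfter_antitone π hpq.le
      -- In general `b (π q) = desAfter π q ≤ desAfter π p ≤ b (π p)`. Equality of the ends leaves
      -- no descent between `p` and `q`, so the index decides the tie.
      by_cases he : a (π q) = a (π p) - 1
      · exact Or.inr ⟨by omega, perm_lt_of_desAfter_eq hpq (by omega)⟩
      · left
        omega

/-- Induction on the weight: in the third case of `straighten_cases`, `x^b e_d` lies in the ideal
and all its other terms have the same degree and smaller weight. -/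
theorem exists_straightening {k : ℕ} (hk : 0 < k) (hkn : k ≤ n) (a : Fin n →₀ ℕ) :
    ∃ v ∈ Submodule.span ℚ (gsSetDeg n k a.degree), monomial a (1 : ℚ) - v ∈ idealI n k := by
  induction hw : straightWeight a using Nat.strong_induction_on generalizing a with
  | _ w ih =>
  rcases straighten_cases hk hkn a with ⟨x, hx⟩ | h | ⟨b, T₀, hab, hT₀, hlt⟩
  · refine ⟨0, Submodule.zero_mem _, ?_⟩
    have : monomial a (1 : ℚ) = monomial (a - Finsupp.single x k) 1 * X x ^ k := by
      rw [X_pow_eq_monomial, monomial_mul, one_mul, tsub_add_cancel_of_le]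
      simpa using hx
    rw [sub_zero, this]
    exact Ideal.mul_mem_left _ _ (Ideal.subset_span (Or.inl ⟨x, rfl⟩))
  · refine ⟨monomial a 1, Submodule.subset_span ⟨h, ?_⟩, by simp⟩
    exact (isHomogeneous_monomial 1 rfl).totalDegree (by simp)
  · have key : ∀ T ∈ (Finset.powersetCard T₀.card Finset.univ).erase T₀,
        ∃ v ∈ Submodule.span ℚ (gsSetDeg n k a.degree),
          monomial (b + indicatorExp T) (1 : ℚ) - v ∈ idealI n k := by
      intro T hT
      simp only [Finset.mem_erase, Finset.mem_powersetCard_univ] at hT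
      have hd : (b + indicatorExp T).degree = a.degree := by
        rw [hab, map_add, map_add, degree_indicatorExp, degree_indicatorExp, hT.2]
      rw [← hd]
      refine ih _ ?_ _ rfl
      rw [← hw, hab]
      exact straightWeight_lt hT.1 hT.2 hlt
    choose! v hv hvI using key
    refine ⟨-∑ T ∈ (Finset.powersetCard T₀.card Finset.univ).erase T₀, v T,
      neg_mem (Submodule.sum_mem _ hv), ?_⟩
    have he : monomial b 1 * esymm (Fin n) ℚ T₀.card ∈ idealI n k :=
      Ideal.mul_mem_left _ _ (Ideal.subset_span (Or.inr ⟨_, hT₀, rfl⟩))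
    rw [monomial_mul_esymm,
      ← Finset.add_sum_erase _ _ (Finset.mem_powersetCard_univ.2 (rfl : T₀.card = _)),
      ← hab] at he
    have := sub_mem he (Ideal.sum_mem _ hvI)
    rw [Finset.sum_sub_distrib] at this
    convert this using 1
    ring

end GarsiaStanton

namespace GarsiaStanton

open MvPolynomial

variable {n k : ℕ}

/-! Evaluation at the points `(σ 1, …, σ n)`, for `σ` an ordered set partition. -/

/-- The evaluation of polynomials at all ordered set partitions, viewed as points of `ℚⁿ`. -/
noncomputable def evalPoints (n k : ℕ) :
    MvPolynomial (Fin n) ℚ →ₐ[ℚ] (OrderedSetPartition n k → ℚ) :=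
  AlgHom.pi fun σ => aeval fun x => ((σ.1 x : ℕ) : ℚ)

theorem evalPoints_apply (p : MvPolynomial (Fin n) ℚ) (σ : OrderedSetPartition n k) :
    evalPoints n k p σ = aeval (fun x => ((σ.1 x : ℕ) : ℚ)) p := rfl

theorem evalPoints_surjective : Function.Surjective (evalPoints n k) := by
  -- Lagrange interpolation: `P σ` vanishes at every point except `σ`.
  let P : OrderedSetPartition n k → MvPolynomial (Fin n) ℚ := fun σ =>
    ∏ x, ∏ c ∈ Finset.univ.erase (σ.1 x), (X x - C ((c : ℕ) : ℚ))
  have hP : ∀ σ τ, evalPoints n k (P σ) τ =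
      ∏ x, ∏ c ∈ Finset.univ.erase (σ.1 x), (((τ.1 x : ℕ) : ℚ) - (c : ℕ)) := by
    intro σ τ
    simp [P, evalPoints_apply, map_prod]
  have h0 : ∀ σ, evalPoints n k (P σ) σ ≠ 0 := by
    intro σ
    rw [hP, Finset.prod_ne_zero_iff]
    intro x _
    rw [Finset.prod_ne_zero_iff]
    intro c hc h
    rw [sub_eq_zero, Nat.cast_inj] at h
    exact (Finset.mem_erase.1 hc).1 (Fin.ext h.symm)
  have h1 : ∀ σ τ, τ ≠ σ → evalPoints n k (P σ) τ = 0 := by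
    intro σ τ hne
    obtain ⟨x, hx⟩ : ∃ x, τ.1 x ≠ σ.1 x := by
      by_contra! h
      exact hne (Subtype.ext (funext h))
    rw [hP]
    refine Finset.prod_eq_zero (Finset.mem_univ x) (Finset.prod_eq_zero (i := τ.1 x) ?_ ?_)
    · simpa using hx
    · simp
  intro g
  refine ⟨∑ σ, (g σ / evalPoints n k (P σ) σ) • P σ, funext fun τ => ?_⟩
  rw [map_sum, Finset.sum_apply, Finset.sum_eq_single τ]
  · rw [map_smul, Pi.smul_apply, smul_eq_mul, div_mul_cancel₀ _ (h0 τ)]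
  · intro σ _ hne
    rw [map_smul, Pi.smul_apply, h1 σ τ hne.symm, smul_zero]
  · simp

/-- The polynomials of degree less than `d`. -/
noncomputable def lowDegree (n d : ℕ) : Submodule ℚ (MvPolynomial (Fin n) ℚ) :=
  Submodule.span ℚ {m | ∃ a : Fin n →₀ ℕ, a.degree < d ∧ m = monomial a 1}

theorem monomial_mul_mem_lowDegree {p : MvPolynomial (Fin n) ℚ} {d : ℕ} (hp : p ∈ lowDegree n d)
    (b : Fin n →₀ ℕ) (r : ℚ) : monomial b r * p ∈ lowDegree n (b.degree + d) := by
  induction hp using Submodule.span_induction with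
  | mem m hm =>
    obtain ⟨a, ha, rfl⟩ := hm
    have h : monomial b r * monomial a 1 = r • monomial (b + a) 1 := by
      rw [monomial_mul, smul_monomial, smul_eq_mul]
    rw [h]
    refine Submodule.smul_mem _ _ (Submodule.subset_span ⟨b + a, ?_, rfl⟩)
    rw [map_add]
    omega
  | zero => simp
  | add x y _ _ hx hy => rw [mul_add]; exact add_mem hx hy
  | smul c x _ hx => rw [mul_smul_comm]; exact Submodule.smul_mem _ _ hx

theorem esymm_mem_lowDegree {c d : ℕ} (h : c < d) : esymm (Fin n) ℚ c ∈ lowDegree n d := by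
  rw [← one_mul (esymm _ _ _), ← C_1, C_apply, monomial_mul_esymm]
  refine Submodule.sum_mem _ fun T hT => Submodule.subset_span ⟨_, ?_, rfl⟩
  rw [zero_add, degree_indicatorExp, (Finset.mem_powersetCard_univ.1 hT)]
  exact h

theorem X_pow_mem_lowDegree {c d : ℕ} (h : c < d) (i : Fin n) : X i ^ c ∈ lowDegree n d := by
  refine Submodule.subset_span ⟨Finsupp.single i c, by simpa using h, ?_⟩
  rw [X_pow_eq_monomial]

/-- Every coordinate is a root of the monic polynomial `∏_{c<k} (t - c)`, whose lower terms
therefore replace `t^k`. -/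
theorem evalPoints_X_pow_mem (i : Fin n) :
    evalPoints n k (X i ^ k) ∈ (lowDegree n k).map (evalPoints n k).toLinearMap := by
  set P : ℚ[X] := ∏ c : Fin k, (Polynomial.X - Polynomial.C ((c : ℕ) : ℚ)) with hP
  have hmonic : P.Monic := Polynomial.monic_prod_X_sub_C _ _
  have hdeg : P.natDegree = k := by
    rw [hP, Polynomial.natDegree_finsetProd_X_sub_C_eq_card, Finset.card_univ, Fintype.card_fin]
  refine ⟨-∑ j ∈ Finset.range k, P.coeff j • X i ^ j, neg_mem (Submodule.sum_mem _ fun j hj =>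
    Submodule.smul_mem _ _ (X_pow_mem_lowDegree (Finset.mem_range.1 hj) i)), funext fun σ => ?_⟩
  have h0 : P.eval ((σ.1 i : ℕ) : ℚ) = 0 := by
    rw [hP, Polynomial.eval_prod]
    exact Finset.prod_eq_zero (Finset.mem_univ (σ.1 i)) (by simp)
  rw [Polynomial.eval_eq_sum_range, hdeg, Finset.sum_range_succ,
    show P.coeff k = 1 from hdeg ▸ hmonic.coeff_natDegree] at h0
  rw [AlgHom.toLinearMap_apply, evalPoints_apply, evalPoints_apply]
  simp only [map_neg, map_sum, map_smul, map_pow, aeval_X, smul_eq_mul]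
  linarith

theorem coeff_prod_one_add (y : Fin n → ℚ) (c : ℕ) :
    (∏ x, (1 + Polynomial.C (y x) * Polynomial.X) : ℚ[X]).coeff c =
      aeval y (esymm (Fin n) ℚ c) := by
  rw [Finset.prod_one_add, Polynomial.finsetSum_coeff, esymm, map_sum]
  have : ∀ T : Finset (Fin n), (∏ x ∈ T, Polynomial.C (y x) * Polynomial.X : ℚ[X]).coeff c =
      if T.card = c then ∏ x ∈ T, y x else 0 := by
    intro T
    rw [Finset.prod_mul_distrib, Finset.prod_const, ← map_prod, Polynomial.coeff_C_mul_X_pow]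
    simp only [eq_comm]
  simp only [this, map_prod, aeval_X]
  rw [← Finset.sum_filter, Finset.powersetCard_eq_filter, Finset.powerset_univ]

/-- One letter chosen from each block accounts for the factors `1 + ct`, `c < k`; the other `n - k`
letters give `Q`. -/
theorem exists_factor (σ : OrderedSetPartition n k) :
    ∃ Q : ℚ[X], Q.natDegree ≤ n - k ∧
      (∏ x, (1 + Polynomial.C ((σ.1 x : ℕ) : ℚ) * Polynomial.X) : ℚ[X]) =
        (∏ c : Fin k, (1 + Polynomial.C ((c : ℕ) : ℚ) * Polynomial.X)) * Q := by
  obtain ⟨s, hs⟩ := σ.2.hasRightInverse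
  have hinj : Function.Injective s := hs.injective
  refine ⟨∏ x ∈ (Finset.univ.map ⟨s, hinj⟩)ᶜ,
    (1 + Polynomial.C ((σ.1 x : ℕ) : ℚ) * Polynomial.X), ?_, ?_⟩
  · refine (Polynomial.natDegree_prod_le _ _).trans ?_
    have h1 : ((Finset.univ.map ⟨s, hinj⟩)ᶜ : Finset (Fin n)).card = n - k := by
      rw [Finset.card_compl]
      simp
    rw [← h1, Finset.card_eq_sum_ones]
    refine Finset.sum_le_sum fun x _ => ?_
    refine Polynomial.natDegree_add_le_of_degree_le (by simp) ?_
    exact (Polynomial.natDegree_C_mul_le _ _).trans Polynomial.natDegree_X_le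
  · rw [← Finset.prod_mul_prod_compl (Finset.univ.map ⟨s, hinj⟩), Finset.prod_map]
    simp only [Function.Embedding.coeFn_mk, hs _]

/-- The series `H = 1/∏_{c<k} (1 + ct)` does not depend on the point, and `H · ∑ e_v(σ) t^v` is a
polynomial of degree at most `n - k`. Its vanishing coefficient at `t^c` expresses `e_c` through
lower `e_v` with the same coefficients at all points. -/
theorem evalPoints_esymm_mem {c : ℕ} (hc : n - k < c) :
    evalPoints n k (esymm (Fin n) ℚ c) ∈ (lowDegree n c).map (evalPoints n k).toLinearMap := by
  set F : ℚ[X] := ∏ c : Fin k, (1 + Polynomial.C ((c : ℕ) : ℚ) * Polynomial.X) with hF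
  have hF0 : PowerSeries.constantCoeff (F : PowerSeries ℚ) = 1 := by
    simp [hF, Polynomial.coeff_zero_eq_eval_zero, Polynomial.eval_prod]
  set H : PowerSeries ℚ := (F : PowerSeries ℚ)⁻¹ with hH
  have hH0 : PowerSeries.coeff 0 H = 1 := by
    rw [PowerSeries.coeff_zero_eq_constantCoeff_apply, hH, PowerSeries.constantCoeff_inv, hF0,
      inv_one]
  refine ⟨-∑ u ∈ (Finset.HasAntidiagonal.antidiagonal c).erase (0, c), PowerSeries.coeff u.1 H •
    esymm (Fin n) ℚ u.2, neg_mem (Submodule.sum_mem _ fun u hu => Submodule.smul_mem _ _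
      (esymm_mem_lowDegree ?_)), funext fun σ => ?_⟩
  · obtain ⟨u, v⟩ := u
    simp only [Finset.mem_erase, ne_eq, Prod.mk.injEq, Finset.HasAntidiagonal.mem_antidiagonal] at hu
    by_contra hlt
    exact hu.1 (by simp only at hlt; omega)
  · obtain ⟨Q, hQ, hE⟩ := exists_factor σ
    have h1 : H * ((∏ x, (1 + Polynomial.C ((σ.1 x : ℕ) : ℚ) * Polynomial.X) : ℚ[X]) :
        PowerSeries ℚ) = Q := by
      rw [hE, Polynomial.coe_mul, ← mul_assoc, hH,
        PowerSeries.inv_mul_cancel _ (by rw [hF0]; exact one_ne_zero), one_mul]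
    have h2 := congrArg (PowerSeries.coeff c) h1
    rw [Polynomial.coeff_coe, Polynomial.coeff_eq_zero_of_natDegree_lt (hQ.trans_lt hc),
      PowerSeries.coeff_mul, ← Finset.add_sum_erase _ _
        (show (0, c) ∈ Finset.HasAntidiagonal.antidiagonal c by simp), hH0] at h2
    simp only [Polynomial.coeff_coe, coeff_prod_one_add] at h2
    rw [AlgHom.toLinearMap_apply, evalPoints_apply, evalPoints_apply]
    simp only [map_neg, map_sum, map_smul, smul_eq_mul]
    linarith

theorem evalPoints_homogeneousComponent_mem {f : MvPolynomial (Fin n) ℚ} (hf : f ∈ idealI n k)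
    (d : ℕ) : evalPoints n k (homogeneousComponent d f) ∈
      (lowDegree n d).map (evalPoints n k).toLinearMap := by
  have hgen : ∀ g : MvPolynomial (Fin n) ℚ, ∀ e, g.IsHomogeneous e →
      evalPoints n k g ∈ (lowDegree n e).map (evalPoints n k).toLinearMap →
      ∀ p : MvPolynomial (Fin n) ℚ, evalPoints n k (homogeneousComponent d (p * g)) ∈
        (lowDegree n d).map (evalPoints n k).toLinearMap := by
    intro g e hg hge p
    induction p using MvPolynomial.induction_on' with
    | monomial b r =>
      have hh : (monomial b r * g).IsHomogeneous (b.degree + e) :=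
        (isHomogeneous_monomial r rfl).mul hg
      rw [homogeneousComponent_of_mem hh]
      split_ifs with h
      · obtain ⟨q, hq, hqg⟩ := hge
        refine ⟨monomial b r * q, h ▸ monomial_mul_mem_lowDegree hq b r, ?_⟩
        simp only [AlgHom.toLinearMap_apply] at hqg ⊢
        rw [map_mul, map_mul, hqg]
      · rw [map_zero]
        exact Submodule.zero_mem _
    | add p q hp hq => rw [add_mul, map_add, map_add]; exact add_mem hp hq
  -- Allowing all multiples `p * f` makes the scalar step of the span induction immediate.
  suffices h : ∀ p, evalPoints n k (homogeneousComponent d (p * f)) ∈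
      (lowDegree n d).map (evalPoints n k).toLinearMap by
    simpa using h 1
  refine Submodule.span_induction (p := fun f _ => ∀ p, evalPoints n k
    (homogeneousComponent d (p * f)) ∈ (lowDegree n d).map (evalPoints n k).toLinearMap)
    ?_ ?_ ?_ ?_ hf
  · rintro g (⟨i, rfl⟩ | ⟨c, hc, rfl⟩)
    · exact hgen _ k (by simpa using (isHomogeneous_X ℚ i).pow k) (evalPoints_X_pow_mem i)
    · refine hgen _ c ?_ (evalPoints_esymm_mem (Nat.lt_of_succ_le hc.1))
      exact IsHomogeneous.sum _ _ _ fun T hT => by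
        simpa [(Finset.mem_powersetCard_univ.1 hT)] using
          IsHomogeneous.prod T (fun x => (X x : MvPolynomial (Fin n) ℚ)) (fun _ => 1)
            fun x _ => isHomogeneous_X ℚ x
  · simp
  · intro x y _ _ hx hy p
    rw [mul_add, map_add, map_add]
    exact add_mem (hx p) (hy p)
  · intro q x _ hx p
    rw [smul_eq_mul, ← mul_assoc]
    exact hx (p * q)

/-! ### Garsia–Stanton monomials span the functions on the points. -/

theorem isHomogeneous_of_mem_gsSetDeg {d : ℕ} {m : MvPolynomial (Fin n) ℚ}
    (hm : m ∈ gsSetDeg n k d) : m.IsHomogeneous d := by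
  obtain ⟨⟨π, i, -, rfl⟩, rfl⟩ := hm
  rw [totalDegree_gsMonomial, ← degree_gsExp, gsMonomial_eq]
  exact isHomogeneous_monomial 1 rfl

theorem span_gsSetDeg_le (n k d : ℕ) :
    Submodule.span ℚ (gsSetDeg n k d) ≤ homogeneousSubmodule (Fin n) ℚ d :=
  Submodule.span_le.2 fun _ hm => isHomogeneous_of_mem_gsSetDeg hm

/-- A monomial minus its straightening is a homogeneous element of the ideal, so on the points it
agrees with a polynomial of lower degree, to which induction applies. -/
theorem map_lowDegree_le (hk : 0 < k) (hkn : k ≤ n) (d : ℕ) :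
    (lowDegree n d).map (evalPoints n k).toLinearMap ≤
      Submodule.span ℚ (evalPoints n k '' {m ∈ gsSet n k | m.totalDegree < d}) := by
  induction d using Nat.strong_induction_on with
  | _ d ih =>
  rw [lowDegree, Submodule.map_span, Submodule.span_le]
  rintro _ ⟨m, ⟨a, ha, rfl⟩, rfl⟩
  obtain ⟨v, hv, hvI⟩ := exists_straightening hk hkn a
  have h1 := evalPoints_homogeneousComponent_mem hvI a.degree
  rw [homogeneousComponent_eq_self ((isHomogeneous_monomial 1 rfl).sub (span_gsSetDeg_le _ _ _ hv)),
    map_sub] at h1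
  have h2 := ih _ ha h1
  have h3 : evalPoints n k v ∈
      Submodule.span ℚ (evalPoints n k '' {m ∈ gsSet n k | m.totalDegree < d}) := by
    have h4 := Submodule.mem_map_of_mem (f := (evalPoints n k).toLinearMap) hv
    rw [Submodule.map_span] at h4
    refine Submodule.span_mono (Set.image_mono ?_) h4
    exact fun m hm => ⟨hm.1, hm.2.trans_lt ha⟩
  have hmono : {m ∈ gsSet n k | m.totalDegree < a.degree} ⊆
      {m ∈ gsSet n k | m.totalDegree < d} := fun m hm => ⟨hm.1, hm.2.trans ha⟩
  have h5 := add_mem (Submodule.span_mono (Set.image_mono hmono) h2) h3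
  rwa [sub_add_cancel] at h5

theorem span_evalPoints_gsSet (hk : 0 < k) (hkn : k ≤ n) :
    ⊤ ≤ Submodule.span ℚ (Set.range fun m : gsSet n k => evalPoints n k m.1) := by
  intro g _
  obtain ⟨p, rfl⟩ := evalPoints_surjective g
  rw [p.as_sum, map_sum]
  refine Submodule.sum_mem _ fun a _ => ?_
  have h1 := map_lowDegree_le hk hkn (a.degree + 1) (Submodule.mem_map_of_mem
    (Submodule.smul_mem _ (p.coeff a) (Submodule.subset_span ⟨a, Nat.lt_succ_self _, rfl⟩)))
  rw [smul_monomial, smul_eq_mul, mul_one] at h1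
  refine Submodule.span_mono ?_ h1
  rintro _ ⟨m, hm, rfl⟩
  exact ⟨⟨m, hm.1⟩, rfl⟩

/-! The basis, given that there are as many Garsia–Stanton monomials as ordered set partitions. -/

theorem linearIndependent_evalPoints (hk : 0 < k) (hkn : k ≤ n)
    (e : OrderedSetPartition n k ≃ gsSet n k) :
    LinearIndependent ℚ fun m : gsSet n k => evalPoints n k m.1 := by
  have := Fintype.ofEquiv _ e
  refine linearIndependent_of_top_le_span_of_card_eq_finrank (span_evalPoints_gsSet hk hkn) ?_
  rw [Module.finrank_fintype_fun_eq_card, Fintype.card_congr e]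

/-- The degree `d` part of a relation modulo the ideal equals, as a function, a combination of
Garsia–Stanton monomials of degree below `d`. Independence of the evaluations makes its coefficients
vanish. -/
theorem linearIndependent_mk (hk : 0 < k) (hkn : k ≤ n)
    (e : OrderedSetPartition n k ≃ gsSet n k) :
    LinearIndependent ℚ fun m : gsSet n k => Ideal.Quotient.mk (idealI n k) m.1 := by
  have hli := linearIndependent_evalPoints hk hkn e
  rw [linearIndependent_iff']
  intro s c hs m₀ hm₀
  have hI : ∑ m ∈ s, c m • m.1 ∈ idealI n k := by
    rw [← Ideal.Quotient.eq_zero_iff_mem, map_sum]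
    exact hs
  set d := m₀.1.totalDegree with hd
  have hcomp : homogeneousComponent d (∑ m ∈ s, c m • m.1) =
      ∑ m ∈ s with m.1.totalDegree = d, c m • m.1 := by
    rw [map_sum, Finset.sum_filter]
    refine Finset.sum_congr rfl fun m _ => ?_
    rw [map_smul, homogeneousComponent_of_mem
      (isHomogeneous_of_mem_gsSetDeg (⟨m.2, rfl⟩ : m.1 ∈ gsSetDeg n k _))]
    by_cases h : m.1.totalDegree = d
    · simp [h]
    · simp [h, Ne.symm h]
  have h1 := map_lowDegree_le hk hkn d (evalPoints_homogeneousComponent_mem hI d)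
  rw [hcomp, map_sum] at h1
  have hdisj := hli.disjoint_span_image
    (s := {m | m.1.totalDegree = d}) (t := {m | m.1.totalDegree < d})
    (Set.disjoint_left.2 fun m hm hm' => by simp only [Set.mem_ofPred_eq] at hm hm'; omega)
  have h2 : ∑ m ∈ s with m.1.totalDegree = d, evalPoints n k (c m • m.1) ∈
      Submodule.span ℚ ((fun m : gsSet n k => evalPoints n k m.1) ''
        {m | m.1.totalDegree = d}) := by
    refine Submodule.sum_mem _ fun m hm => ?_
    rw [map_smul]
    exact Submodule.smul_mem _ _ (Submodule.subset_span ⟨m, (Finset.mem_filter.1 hm).2, rfl⟩)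
  have h3 := Submodule.disjoint_def.1 hdisj _ h2 (Submodule.span_mono (by
    rintro _ ⟨m, hm, rfl⟩
    exact ⟨⟨m, hm.1⟩, hm.2, rfl⟩) h1)
  simp only [map_smul] at h3
  exact linearIndependent_iff'.1 hli _ c h3 m₀ (Finset.mem_filter.2 ⟨hm₀, rfl⟩)

theorem gradedPiece_eq_span (hk : 0 < k) (hkn : k ≤ n) (d : ℕ) :
    gradedPiece n k d = Submodule.span ℚ (Ideal.Quotient.mk (idealI n k) '' gsSetDeg n k d) := by
  have himage := Submodule.map_span (Ideal.Quotient.mkₐ ℚ (idealI n k)).toLinearMap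
    (gsSetDeg n k d)
  refine le_antisymm ?_ ?_
  · rintro _ ⟨p, hp, rfl⟩
    rw [p.as_sum, map_sum]
    refine Submodule.sum_mem _ fun a ha => ?_
    obtain ⟨v, hv, hvI⟩ := exists_straightening hk hkn a
    rw [show a.degree = d from (hp.degree_eq_sum_deg_support ha).symm] at hv
    have h1 : (Ideal.Quotient.mkₐ ℚ (idealI n k)).toLinearMap (monomial a 1) =
        (Ideal.Quotient.mkₐ ℚ (idealI n k)).toLinearMap v := Ideal.Quotient.eq.2 hvI
    rw [← mul_one (p.coeff a), ← smul_eq_mul, ← smul_monomial, map_smul, h1]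
    refine Submodule.smul_mem _ _ ?_
    have h2 := Submodule.mem_map_of_mem (f := (Ideal.Quotient.mkₐ ℚ (idealI n k)).toLinearMap) hv
    rwa [himage] at h2
  · refine himage.symm.le.trans (Submodule.map_mono (span_gsSetDeg_le n k d))

theorem span_mk_gsSet (hk : 0 < k) (hkn : k ≤ n) :
    ⊤ ≤ Submodule.span ℚ (Set.range fun m : gsSet n k =>
      Ideal.Quotient.mk (idealI n k) m.1) := by
  intro g _
  obtain ⟨p, rfl⟩ := Ideal.Quotient.mk_surjective g
  rw [← sum_homogeneousComponent p, map_sum]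
  refine Submodule.sum_mem _ fun d _ => ?_
  have h1 : Ideal.Quotient.mk (idealI n k) (homogeneousComponent d p) ∈ gradedPiece n k d :=
    Submodule.mem_map_of_mem (f := (Ideal.Quotient.mkₐ ℚ (idealI n k)).toLinearMap)
      (homogeneousComponent_isHomogeneous d p)
  rw [gradedPiece_eq_span hk hkn] at h1
  refine Submodule.span_mono ?_ h1
  rintro _ ⟨m, hm, rfl⟩
  exact ⟨⟨m, hm.1⟩, rfl⟩

theorem finrank_gradedPiece (hk : 0 < k) (hkn : k ≤ n)
    (e : OrderedSetPartition n k ≃ gsSet n k) (d : ℕ) :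
    Module.finrank ℚ (gradedPiece n k d) =
      (Finset.univ.filter fun σ => (e σ).1.totalDegree = d).card := by
  have hli := (linearIndependent_mk hk hkn e).comp
    (fun σ : {σ // (e σ).1.totalDegree = d} => e σ.1)
    (e.injective.comp Subtype.val_injective)
  have hset : Ideal.Quotient.mk (idealI n k) '' gsSetDeg n k d =
      Set.range fun σ : {σ // (e σ).1.totalDegree = d} =>
        Ideal.Quotient.mk (idealI n k) (e σ.1).1 := by
    ext r
    constructor
    · rintro ⟨m, hm, rfl⟩
      exact ⟨⟨e.symm ⟨m, hm.1⟩, by simpa using hm.2⟩, by simp⟩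
    · rintro ⟨σ, rfl⟩
      exact ⟨_, ⟨(e σ.1).2, σ.2⟩, rfl⟩
  rw [gradedPiece_eq_span hk hkn, hset, ← Fintype.card_subtype]
  exact finrank_span_eq_card hli

end GarsiaStanton

namespace GarsiaStanton

variable {n k : ℕ}

/-! Ascents, and their ranks counted from the right. -/

theorem ascSet_eq_sdiff (π : Equiv.Perm (Fin n)) : ascSet π = Finset.Ico 1 n \ desSet π := by
  ext i
  rw [Finset.mem_sdiff]
  constructor
  · intro hi
    have hi' := Finset.mem_Ico.1 (ascSet_subset_Ico π hi)
    refine ⟨ascSet_subset_Ico π hi, fun hd => ?_⟩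
    have h : ((⟨i - 1, by omega⟩ : Fin n) : ℕ) + 1 = (⟨i, hi'.2⟩ : Fin n) :=
      Nat.sub_add_cancel hi'.1
    exact lt_asymm ((mem_ascSet_iff h).1 hi) ((mem_desSet_iff h).1 hd)
  · rintro ⟨hi, hd⟩
    have hi' := Finset.mem_Ico.1 hi
    have h : ((⟨i - 1, by omega⟩ : Fin n) : ℕ) + 1 = (⟨i, hi'.2⟩ : Fin n) :=
      Nat.sub_add_cancel hi'.1
    refine (mem_ascSet_iff h).2 (lt_of_le_of_ne (not_lt.1 fun hlt => hd ?_) fun e => ?_)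
    · exact (mem_desSet_iff h).2 hlt
    · have := congrArg Fin.val (π.injective e)
      simp only at this
      omega

theorem card_ascSet_add_des (π : Equiv.Perm (Fin n)) : (ascSet π).card + des π = n - 1 := by
  rw [ascSet_eq_sdiff, des, Finset.card_sdiff_add_card_eq_card (desSet_subset_Ico π), Nat.card_Ico]

theorem sum_ascSet_add_maj (π : Equiv.Perm (Fin n)) :
    ∑ i ∈ ascSet π, i + maj π = ∑ i ∈ Finset.Ico 1 n, i := by
  rw [ascSet_eq_sdiff, maj, Finset.sum_sdiff (desSet_subset_Ico π)]

theorem maj_revPerm_mul (π : Equiv.Perm (Fin n)) :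
    maj (Fin.revPerm * π) = ∑ i ∈ ascSet π, i := by
  have h : desSet (Fin.revPerm * π) = ascSet π := by
    ext i
    simp [desSet, ascSet]
  rw [maj, h]

/-- The number of elements of `A` in `{s, …, n - 1}`. -/
def rankFrom (n : ℕ) (A : Finset ℕ) (s : ℕ) : ℕ := (A ∩ Finset.Ico s n).card

section rank

variable {A : Finset ℕ} {m : ℕ} {t : Fin m → ℕ}

theorem rankFrom_strictAnti (hA : A ⊆ Finset.Ico 1 n) {s s' : ℕ} (hs : s ∈ A) (h : s < s') :
    rankFrom n A s' < rankFrom n A s := by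
  refine Finset.card_lt_card ⟨fun x hx => ?_, fun hsub => ?_⟩
  · simp only [Finset.mem_inter, Finset.mem_Ico] at hx ⊢
    exact ⟨hx.1, by omega, hx.2.2⟩
  · have := hsub (Finset.mem_inter.2
      ⟨hs, Finset.mem_Ico.2 ⟨le_rfl, (Finset.mem_Ico.1 (hA hs)).2⟩⟩)
    simp only [Finset.mem_inter, Finset.mem_Ico] at this
    omega

theorem rankFrom_injOn (hA : A ⊆ Finset.Ico 1 n) : Set.InjOn (rankFrom n A) A := by
  intro s hs s' hs' h
  rcases lt_trichotomy s s' with hlt | rfl | hlt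
  · exact absurd h (rankFrom_strictAnti hA hs hlt).ne'
  · rfl
  · exact absurd h (rankFrom_strictAnti hA hs' hlt).ne

theorem sub_le_rankFrom (hA : A ⊆ Finset.Ico 1 n) (ht : StrictMono t) (htA : ∀ j, t j ∈ A)
    (j : Fin m) : m - j ≤ rankFrom n A (t j) := by
  rw [← Fin.card_Ici, ← Finset.card_map ⟨t, ht.injective⟩]
  refine Finset.card_le_card fun x hx => ?_
  simp only [Finset.mem_map, Finset.mem_Ici, Function.Embedding.coeFn_mk] at hx
  obtain ⟨i, hi, rfl⟩ := hx
  exact Finset.mem_inter.2 ⟨htA i, Finset.mem_Ico.2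
    ⟨ht.monotone hi, (Finset.mem_Ico.1 (hA (htA i))).2⟩⟩

theorem rankFrom_add_le_card (ht : StrictMono t) (htA : ∀ j, t j ∈ A) (j : Fin m) :
    rankFrom n A (t j) + j ≤ A.card := by
  rw [← Fin.card_Iio j, ← Finset.card_map ⟨t, ht.injective⟩, rankFrom,
    ← Finset.card_union_of_disjoint]
  · refine Finset.card_le_card (Finset.union_subset Finset.inter_subset_left fun x hx => ?_)
    simp only [Finset.mem_map, Function.Embedding.coeFn_mk] at hx
    obtain ⟨i, -, rfl⟩ := hx
    exact htA i
  · rw [Finset.disjoint_left]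
    intro x hx hx'
    simp only [Finset.mem_map, Finset.mem_Iio, Function.Embedding.coeFn_mk] at hx'
    obtain ⟨i, hi, rfl⟩ := hx'
    exact (ht hi).not_ge (Finset.mem_Ico.1 (Finset.mem_inter.1 hx).2).1

theorem rankFrom_add_sub_le (hA : A ⊆ Finset.Ico 1 n) (ht : StrictMono t) (htA : ∀ j, t j ∈ A)
    {i j : Fin m} (hij : i ≤ j) : rankFrom n A (t j) + (j - i) ≤ rankFrom n A (t i) := by
  rw [← Fin.card_Ico i j, ← Finset.card_map ⟨t, ht.injective⟩, rankFrom,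
    ← Finset.card_union_of_disjoint]
  · refine Finset.card_le_card (Finset.union_subset ?_ fun x hx => ?_)
    · exact Finset.inter_subset_inter_left (Finset.Ico_subset_Ico_left (ht.monotone hij))
    · simp only [Finset.mem_map, Finset.mem_Ico, Function.Embedding.coeFn_mk] at hx
      obtain ⟨l, hl, rfl⟩ := hx
      exact Finset.mem_inter.2 ⟨htA l, Finset.mem_Ico.2
        ⟨ht.monotone hl.1, (Finset.mem_Ico.1 (hA (htA l))).2⟩⟩
  · rw [Finset.disjoint_left]
    intro x hx hx'
    simp only [Finset.mem_map, Finset.mem_Ico, Function.Embedding.coeFn_mk] at hx'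
    obtain ⟨l, hl, rfl⟩ := hx'
    exact (ht hl.2).not_ge (Finset.mem_Ico.1 (Finset.mem_inter.1 hx).2).1

theorem rankFrom_orderEmbOfFin (hA : A ⊆ Finset.Ico 1 n) (h : A.card = m) (j : Fin m) :
    rankFrom n A (A.orderEmbOfFin h j) = m - j := by
  have h1 := sub_le_rankFrom hA (A.orderEmbOfFin h).strictMono
    (fun j => A.orderEmbOfFin_mem h j) j
  have h2 := rankFrom_add_le_card (n := n) (A.orderEmbOfFin h).strictMono
    (fun j => A.orderEmbOfFin_mem h j) j
  omega

end rank

/-! Ordered set partitions in star notation. -/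

/-- The number of elements of `{1, …, q}` outside `S`. -/
def gapCount (S : Finset ℕ) (q : ℕ) : ℕ := (Finset.Icc 1 q \ S).card

theorem gapCount_zero (S : Finset ℕ) : gapCount S 0 = 0 := by simp [gapCount]

theorem gapCount_succ (S : Finset ℕ) (q : ℕ) :
    gapCount S (q + 1) = gapCount S q + if q + 1 ∈ S then 0 else 1 := by
  rw [gapCount, gapCount, ← Finset.insert_Icc_right_eq_Icc_add_one (by omega)]
  split_ifs with h
  · rw [Finset.insert_sdiff_of_mem _ h, add_zero]
  · rw [Finset.insert_sdiff_of_notMem _ h, Finset.card_insert_of_notMem (by simp)]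

theorem gapCount_mono (S : Finset ℕ) : Monotone (gapCount S) := fun _ _ h =>
  Finset.card_le_card (Finset.sdiff_subset_sdiff (Finset.Icc_subset_Icc_right h) le_rfl)

theorem gapCount_last {S : Finset ℕ} (hS : S ⊆ Finset.Ico 1 n) :
    gapCount S (n - 1) + S.card = n - 1 := by
  have h : Finset.Icc 1 (n - 1) = Finset.Ico 1 n := by
    ext
    simp only [Finset.mem_Icc, Finset.mem_Ico]
    omega
  rw [gapCount, h, Finset.card_sdiff_add_card_eq_card hS, Nat.card_Ico]

namespace OrderedSetPartition

theorem mem_stars_iff (σ : OrderedSetPartition n k) {p q : Fin n} (h : (p : ℕ) + 1 = q) :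
    (q : ℕ) ∈ σ.stars ↔ σ.1 (σ.perm p) = σ.1 (σ.perm q) := by
  simp only [stars, Finset.mem_filter, Finset.mem_Ico]
  constructor
  · rintro ⟨-, a, b, ha, hb, hab⟩
    obtain rfl : b = q := Fin.ext hb
    obtain rfl : a = p := Fin.ext (by omega)
    exact hab
  · intro hab
    exact ⟨⟨by omega, q.2⟩, p, q, h, rfl, hab⟩

theorem monotone_perm (σ : OrderedSetPartition n k) : Monotone (σ.1 ∘ σ.perm) :=
  Tuple.monotone_sort σ.1

/-- Along `perm` the block index stays fixed at a star and otherwise grows by exactly one, since no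
block is empty. -/
theorem apply_perm (σ : OrderedSetPartition n k) (p : Fin n) :
    (σ.1 (σ.perm p) : ℕ) = gapCount σ.stars p := by
  have hsurj : ∀ c, ∃ q, σ.1 (σ.perm q) = c := fun c => by
    obtain ⟨x, hx⟩ := σ.2 c
    exact ⟨σ.perm.symm x, by simpa using hx⟩
  obtain ⟨p, hp⟩ := p
  induction p with
  | zero =>
    have hk : 0 < k := Fin.pos (σ.1 (σ.perm ⟨0, hp⟩))
    obtain ⟨q, hq⟩ := hsurj ⟨0, hk⟩
    have h := σ.monotone_perm (a := ⟨0, hp⟩) (b := q) (by simp [Fin.le_def])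
    simp only [Function.comp_apply, hq, Fin.le_def] at h
    simp only [gapCount_zero]
    omega
  | succ p ih =>
    have hp' : p < n := by omega
    specialize ih hp'
    have hstar := σ.mem_stars_iff (p := ⟨p, hp'⟩) (q := ⟨p + 1, hp⟩) rfl
    simp only at hstar ih ⊢
    rw [gapCount_succ, ← ih]
    have hle := σ.monotone_perm (a := ⟨p, hp'⟩) (b := ⟨p + 1, hp⟩) (by simp [Fin.le_def])
    simp only [Function.comp_apply, Fin.le_def] at hle
    split_ifs with h
    · rw [← hstar.1 h, add_zero]
    · rw [hstar, Fin.ext_iff] at h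
      by_contra hne
      have hlt := (σ.1 (σ.perm ⟨p + 1, hp⟩)).2
      obtain ⟨q, hq⟩ := hsurj ⟨σ.1 (σ.perm ⟨p, hp'⟩) + 1, by omega⟩
      have hq' := congrArg Fin.val hq
      simp only at hq'
      rcases Nat.lt_or_ge p q with hpq | hpq
      · have := σ.monotone_perm (a := ⟨p + 1, hp⟩) (b := q) (by rw [Fin.le_def]; exact hpq)
        simp only [Function.comp_apply, Fin.le_def] at this
        omega
      · have := σ.monotone_perm (a := q) (b := ⟨p, hp'⟩) (by rw [Fin.le_def]; exact hpq)
        simp only [Function.comp_apply, Fin.le_def] at this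
        omega

theorem ext_perm_stars {σ τ : OrderedSetPartition n k} (hp : σ.perm = τ.perm)
    (hs : σ.stars = τ.stars) : σ = τ := by
  refine Subtype.ext (funext fun x => Fin.ext ?_)
  have h1 := σ.apply_perm (σ.perm.symm x)
  have h2 := τ.apply_perm (τ.perm.symm x)
  rw [Equiv.apply_symm_apply] at h1 h2
  rw [h1, h2, hp, hs]

theorem card_stars (hk : 0 < k) (σ : OrderedSetPartition n k) : σ.stars.card = n - k := by
  obtain ⟨x, hx⟩ := σ.2 ⟨k - 1, by omega⟩
  have hxn := x.2
  have h1 := σ.apply_perm (σ.perm.symm x)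
  have h2 := σ.apply_perm ⟨n - 1, by omega⟩
  have h3 := gapCount_mono σ.stars (Nat.le_pred_of_lt (σ.perm.symm x).2)
  have h4 := gapCount_last (σ.stars_subset_ascSet.trans (ascSet_subset_Ico σ.perm))
  have h5 := (σ.1 (σ.perm ⟨n - 1, by omega⟩)).2
  rw [Equiv.apply_symm_apply, hx] at h1
  simp only [Nat.pred_eq_sub_one] at h1 h2 h3
  omega

theorem exists_perm_stars (hk : 0 < k) (hkn : k ≤ n) {π : Equiv.Perm (Fin n)} {S : Finset ℕ}
    (hS : S ⊆ ascSet π) (hc : S.card = n - k) :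
    ∃ σ : OrderedSetPartition n k, σ.perm = π ∧ σ.stars = S := by
  have hSn := hS.trans (ascSet_subset_Ico π)
  have hlast := gapCount_last hSn
  have hlt : ∀ p : Fin n, gapCount S p < k := by
    intro p
    have := gapCount_mono S (Nat.le_pred_of_lt p.2)
    simp only [Nat.pred_eq_sub_one] at this
    omega
  let f : Fin n → Fin k := fun x => ⟨gapCount S (π.symm x), hlt _⟩
  have hf : ∀ p, (f (π p) : ℕ) = gapCount S p := fun p => by simp [f]
  have hsurj : Function.Surjective f := by
    intro c
    -- `gapCount` starts at 0 and grows by at most one per step, so it equals `c` where it first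
    -- reaches `c`.
    have hex : ∃ q, (c : ℕ) ≤ gapCount S q := ⟨n - 1, by have := c.2; omega⟩
    have hle : Nat.find hex ≤ n - 1 := Nat.find_min' hex (by have := c.2; omega)
    refine ⟨π ⟨Nat.find hex, by omega⟩, Fin.ext ?_⟩
    rw [hf]
    refine le_antisymm ?_ (Nat.find_spec hex)
    simp only
    rcases h0 : Nat.find hex with _ | q
    · simp [gapCount_zero]
    · have := Nat.find_min hex (m := q) (by omega)
      rw [gapCount_succ]
      split_ifs <;> omega
  let σ : OrderedSetPartition n k := ⟨f, hsurj⟩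
  have hstep : ∀ u v : Fin n, (u : ℕ) + 1 = v → (f (π u) = f (π v) ↔ (v : ℕ) ∈ S) := by
    intro u v huv
    rw [Fin.ext_iff, hf, hf, ← huv, gapCount_succ]
    split_ifs with h <;> simp [h]
  have hperm : π = σ.perm := by
    refine Tuple.eq_sort_iff.2 ⟨fun p q hpq => ?_, fun p q hpq he => ?_⟩
    · rw [Function.comp_apply, Function.comp_apply, Fin.le_def]
      change (f (π p) : ℕ) ≤ f (π q)
      rw [hf, hf]
      exact gapCount_mono S hpq
    · change f (π p) = f (π q) at he
      rw [Fin.ext_iff, hf, hf] at he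
      -- Equal gap counts mean that every position in between is starred, hence an ascent.
      refine rel_of_adjacent (r := fun p q => π p < π q) (fun _ _ _ => lt_trans) hpq ?_
      intro u v hu hv huv
      rw [← mem_ascSet_iff huv]
      refine hS ((hstep u v huv).1 (Fin.ext ?_))
      have h1 := gapCount_mono S hu
      have h2 := gapCount_mono S hv
      have h3 := gapCount_mono S (show (u : ℕ) ≤ v by omega)
      rw [hf, hf]
      omega
  refine ⟨σ, hperm.symm, ?_⟩
  ext i
  by_cases hi : i ∈ Finset.Ico 1 n
  · have hi' := Finset.mem_Ico.1 hi
    have h : ((⟨i - 1, by omega⟩ : Fin n) : ℕ) + 1 = (⟨i, hi'.2⟩ : Fin n) :=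
      Nat.sub_add_cancel hi'.1
    have h1 := σ.mem_stars_iff h
    rw [← hperm] at h1
    exact h1.trans (hstep _ _ h)
  · exact ⟨fun h => absurd (ascSet_subset_Ico _ (σ.stars_subset_ascSet h)) hi,
      fun h => absurd (hSn h) hi⟩

/-! The bijection with Garsia–Stanton monomials. -/

/-- The ranks of the stars among the ascents, turned into a weakly decreasing sequence. -/
def starExp (hk : 0 < k) (σ : OrderedSetPartition n k) (j : Fin (n - k)) : ℕ :=
  rankFrom n (ascSet σ.perm) (σ.stars.orderEmbOfFin (σ.card_stars hk) j) - (n - k - j)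

theorem orderEmbOfFin_stars_mem (hk : 0 < k) (σ : OrderedSetPartition n k) (j : Fin (n - k)) :
    σ.stars.orderEmbOfFin (σ.card_stars hk) j ∈ ascSet σ.perm :=
  σ.stars_subset_ascSet (Finset.orderEmbOfFin_mem _ _ j)

theorem starExp_add (hk : 0 < k) (σ : OrderedSetPartition n k) (j : Fin (n - k)) :
    σ.starExp hk j + (n - k - j) =
      rankFrom n (ascSet σ.perm) (σ.stars.orderEmbOfFin (σ.card_stars hk) j) :=
  Nat.sub_add_cancel (sub_le_rankFrom (ascSet_subset_Ico _)
    (σ.stars.orderEmbOfFin (σ.card_stars hk)).strictMono (σ.orderEmbOfFin_stars_mem hk) j)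

/-- Subtracting the staircase makes the strictly decreasing ranks weakly decreasing, with upper
bound `|Asc π| - (n - k) = k - 1 - des π`. -/
theorem isAdmissible_starExp (hk : 0 < k) (hkn : k ≤ n) (σ : OrderedSetPartition n k) :
    IsAdmissible k σ.perm (σ.starExp hk) := by
  have hA := card_ascSet_add_des σ.perm
  have hcard := Finset.card_le_card σ.stars_subset_ascSet
  rw [σ.card_stars hk] at hcard
  refine ⟨by omega, fun i j hij => ?_, fun j => ?_⟩
  · have h1 := rankFrom_add_sub_le (ascSet_subset_Ico σ.perm)
      (σ.stars.orderEmbOfFin (σ.card_stars hk)).strictMono (σ.orderEmbOfFin_stars_mem hk) hij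
    have h2 := σ.starExp_add hk i
    have h3 := σ.starExp_add hk j
    have hj := j.2
    rw [Fin.le_def] at hij
    omega
  · have h1 := rankFrom_add_le_card (n := n)
      (σ.stars.orderEmbOfFin (σ.card_stars hk)).strictMono (σ.orderEmbOfFin_stars_mem hk) j
    have h2 := σ.starExp_add hk j
    have hj := j.2
    omega

theorem ext_perm_starExp (hk : 0 < k) {σ τ : OrderedSetPartition n k} (hp : σ.perm = τ.perm)
    (he : σ.starExp hk = τ.starExp hk) : σ = τ := by
  refine ext_perm_stars hp ?_
  have h : ∀ j, σ.stars.orderEmbOfFin (σ.card_stars hk) j =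
      τ.stars.orderEmbOfFin (τ.card_stars hk) j := by
    intro j
    refine rankFrom_injOn (ascSet_subset_Ico σ.perm) (σ.orderEmbOfFin_stars_mem hk j) ?_ ?_
    · rw [hp]
      exact τ.orderEmbOfFin_stars_mem hk j
    · rw [← starExp_add hk, he, starExp_add, hp]
  apply Finset.coe_injective
  rw [← Finset.range_orderEmbOfFin _ (σ.card_stars hk),
    ← Finset.range_orderEmbOfFin _ (τ.card_stars hk), funext h]

theorem exists_perm_starExp (hk : 0 < k) (hkn : k ≤ n) {π : Equiv.Perm (Fin n)}
    {i : Fin (n - k) → ℕ} (hi : IsAdmissible k π i) :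
    ∃ σ : OrderedSetPartition n k, σ.perm = π ∧ σ.starExp hk = i := by
  obtain ⟨hdes, hanti, hlt⟩ := hi
  have hA := card_ascSet_add_des π
  have hle : ∀ j, i j + (n - k - j) ≤ (ascSet π).card := fun j => by
    have := hlt j
    omega
  -- Counted from 0, the ascent with index `|Asc π| - r` has rank `r` from the right.
  let t : Fin (n - k) → ℕ := fun j => (ascSet π).orderEmbOfFin rfl
    ⟨(ascSet π).card - (i j + (n - k - j)), by have := hle j; have := j.2; omega⟩
  have htA : ∀ j, t j ∈ ascSet π := fun j => Finset.orderEmbOfFin_mem _ _ _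
  have hrank : ∀ j, rankFrom n (ascSet π) (t j) = i j + (n - k - j) := by
    intro j
    rw [rankFrom_orderEmbOfFin (ascSet_subset_Ico π)]
    exact Nat.sub_sub_self (hle j)
  have ht : StrictMono t := by
    intro j l hjl
    refine ((ascSet π).orderEmbOfFin rfl).strictMono ?_
    have h1 := hanti hjl.le
    have h2 := hle j
    have h3 := l.2
    rw [Fin.lt_def] at hjl ⊢
    simp only
    omega
  obtain ⟨σ, rfl, hS⟩ := exists_perm_stars hk hkn (π := π) (S := Finset.univ.map ⟨t, ht.injective⟩)
    (by
      intro x hx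
      simp only [Finset.mem_map, Finset.mem_univ, true_and, Function.Embedding.coeFn_mk] at hx
      obtain ⟨j, rfl⟩ := hx
      exact htA j)
    (by simp)
  refine ⟨σ, rfl, funext fun j => ?_⟩
  have h1 := Finset.orderEmbOfFin_unique (σ.card_stars hk) (f := t)
    (fun x => by rw [hS]; simp) ht
  have h2 := σ.starExp_add hk j
  rw [← h1, hrank] at h2
  omega

/-- The Garsia–Stanton monomial of an ordered set partition. -/
noncomputable def toMonomial (hk : 0 < k) (hkn : k ≤ n) (σ : OrderedSetPartition n k) :
    gsSet n k :=
  ⟨gsMonomial k σ.perm (σ.starExp hk), σ.perm, σ.starExp hk, σ.isAdmissible_starExp hk hkn, rfl⟩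

theorem toMonomial_bijective (hk : 0 < k) (hkn : k ≤ n) :
    Function.Bijective (toMonomial (n := n) hk hkn) := by
  constructor
  · intro σ τ h
    obtain ⟨h1, h2⟩ := gsMonomial_injective (σ.isAdmissible_starExp hk hkn).2.1
      (τ.isAdmissible_starExp hk hkn).2.1 (congrArg Subtype.val h)
    exact ext_perm_starExp hk h1 h2
  · rintro ⟨_, π, i, hi, rfl⟩
    obtain ⟨σ, rfl, rfl⟩ := exists_perm_starExp hk hkn hi
    exact ⟨σ, rfl⟩

/-- Ascents and descents partition `{1, …, n-1}`, and the ranks of the stars sum to the exponents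
plus the staircase. -/
theorem maj_add (hk : 0 < k) (σ : OrderedSetPartition n k) :
    σ.maj + (GarsiaStanton.maj σ.perm + ∑ j, σ.starExp hk j) + ∑ j : Fin (n - k), (n - k - j) =
      ∑ i ∈ Finset.Ico 1 n, i := by
  have h1 := σ.starSum_le_maj
  have h2 : ∑ i ∈ σ.stars, (ascSet σ.perm ∩ Finset.Ico i n).card =
      ∑ j, σ.starExp hk j + ∑ j : Fin (n - k), (n - k - j) := by
    rw [← Finset.sum_add_distrib]
    simp only [starExp_add]
    conv_lhs => rw [← Finset.image_orderEmbOfFin_univ σ.stars (σ.card_stars hk)]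
    rw [Finset.sum_image fun a _ b _ h => (σ.stars.orderEmbOfFin _).injective h]
    rfl
  have h3 := sum_ascSet_add_maj σ.perm
  rw [maj]
  rw [maj_revPerm_mul, h2] at h1 ⊢
  omega

theorem comaj_eq (hk : 0 < k) (hkn : k ≤ n) (σ : OrderedSetPartition n k) :
    σ.comaj = GarsiaStanton.maj σ.perm + ∑ j, σ.starExp hk j := by
  have hdes : desSet (1 : Equiv.Perm (Fin n)) = ∅ := by
    refine Finset.filter_eq_empty_iff.2 fun i _ => ?_
    rintro ⟨a, b, ha, hb, hab⟩
    simp only [Equiv.Perm.one_apply, Fin.lt_def] at hab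
    omega
  -- The identity with the zero sequence has degree 0, so it attains the maximum of `maj`.
  obtain ⟨τ, h1, h2⟩ := exists_perm_starExp hk hkn (π := 1) (i := fun _ => 0)
    ⟨by rw [des, hdes]; exact hk, fun _ _ _ => le_rfl, fun _ => by rw [des, hdes]; exact hk⟩
  have hτ : GarsiaStanton.maj τ.perm + ∑ j, τ.starExp hk j = 0 := by
    rw [h1, h2, GarsiaStanton.maj, hdes]
    simp
  have hτ' := τ.maj_add hk
  have hσ := σ.maj_add hk
  have hsup : (Finset.univ.sup fun τ : OrderedSetPartition n k => τ.maj) = τ.maj := by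
    refine le_antisymm (Finset.sup_le fun ρ _ => ?_) (Finset.le_sup (f := fun τ => τ.maj)
      (Finset.mem_univ τ))
    have := ρ.maj_add hk
    omega
  rw [comaj, hsup]
  omega

theorem totalDegree_toMonomial (hk : 0 < k) (hkn : k ≤ n) (σ : OrderedSetPartition n k) :
    (σ.toMonomial hk hkn).1.totalDegree = σ.comaj := by
  rw [σ.comaj_eq hk hkn]
  exact totalDegree_gsMonomial k σ.perm _

end OrderedSetPartition

end GarsiaStanton

/-! ### The basis and the Hilbert series. -/

theorem mainTheorem6 (n k : ℕ) (hk : 0 < k) (hkn : k ≤ n) :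
    (∃ b : Module.Basis (gsSet n k) ℚ (ringR n k),
      ∀ m : gsSet n k, b m = Ideal.Quotient.mk (idealI n k) m.1) ∧
    (∀ (π π' : Equiv.Perm (Fin n)) (i i' : Fin (n - k) → ℕ),
      IsAdmissible k π i → IsAdmissible k π' i' →
        gsMonomial k π i = gsMonomial k π' i' → π = π' ∧ i = i') ∧
    (∃ hfin : (gsSet n k).Finite,
      ∑ m ∈ hfin.toFinset, (Polynomial.X : ℕ[X]) ^ m.totalDegree =
        ∑ σ : OrderedSetPartition n k, (Polynomial.X : ℕ[X]) ^ σ.comaj) ∧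
    hilbertSeries n k =
      ((∑ σ : OrderedSetPartition n k, (Polynomial.X : ℕ[X]) ^ σ.comaj : ℕ[X]) :
        PowerSeries ℕ) := by
  let e : OrderedSetPartition n k ≃ gsSet n k :=
    Equiv.ofBijective _ (OrderedSetPartition.toMonomial_bijective hk hkn)
  have he : ∀ σ, (e σ).1.totalDegree = σ.comaj :=
    OrderedSetPartition.totalDegree_toMonomial hk hkn
  refine ⟨⟨Module.Basis.mk (linearIndependent_mk hk hkn e) (span_mk_gsSet hk hkn), fun m =>
    Module.Basis.mk_apply _ _ m⟩, fun π π' i i' hi hi' => gsMonomial_injective hi.2.1 hi'.2.1,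
    ⟨Set.finite_coe_iff.1 (Finite.of_equiv _ e), ?_⟩, ?_⟩
  · symm
    refine Finset.sum_bij (fun σ _ => (e σ).1) (fun σ _ => ?_) (fun σ _ τ _ h => ?_)
      (fun m hm => ?_) (fun σ _ => ?_)
    · simp
    · exact e.injective (Subtype.ext h)
    · exact ⟨e.symm ⟨m, by simpa using hm⟩, Finset.mem_univ _, by simp⟩
    · rw [he]
  · ext d
    rw [hilbertSeries, PowerSeries.coeff_mk, finrank_gradedPiece hk hkn e, Polynomial.coeff_coe,
      Polynomial.finsetSum_coeff, Finset.card_filter]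
    simp only [he, Polynomial.coeff_X_pow, eq_comm]
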